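/- Let $G$ be a $\sigma$-compact locally compact (Hausdorff) abelian group, fix a compact set $K\subset G$ with non-empty interior, and let $\Lambda\subset G$ be relatively dense (i.e. $\Lambda+C=G$ for some compact $C$) and period-stable (i.e. every subgroup $P\le G$ with $P\subset\Lambda-\Lambda$ satisfies $P+\Lambda=\Lambda$). Then the following statements are equivalent. (i) $\Lambda$ is a model set: there are a locally compact Hausdorff abelian group $H$, a lattice (discrete co-compact subgroup) $\mathcal L\subset G\times H$ such that the projection $\pi_1:\mathcal L\to G$ is injective and $\pi_2(\mathcal L)$ is dense in $H$, and a relatively compact set $W\subset H$ with non-empty interior, such that $\Lambda=\{x\in G : (x,y)\in\mathcal L\text{ for some }y\in W\}$. (ii) $\Lambda$ has finite local complexity (i.e. $\Lambda-\Lambda$ has finite intersection with every compact set), and there is a positive sup-almost periodic measure $\eta\neq0$ with $\eta\le\delta_\Lambda$. (iii) $\Lambda$ has finite local complexity, and there is a positive norm-almost periodic measure $\eta\neq0$ with $\eta\le\delta_\Lambda$. (iv) $\Lambda-\Lambda$ is uniformly discrete (i.e. there is a neighbourhood $U$ of $0$ such that the sets $x+U$, $x\in\Lambda-\Lambda$,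 are pairwise disjoint), and there is a positive strongly almost periodic measure $\eta\neq0$ with $\eta\le\delta_\Lambda$. Here $\delta_\Lambda=\sum_{x\in\Lambda}\delta_x$ and $T_t\eta(B)=\eta(B-t)$. A positive measure $\eta$ on $G$ is *sup-almost periodic* if it is discrete (pure point) and, for every $\varepsilon>0$, the set of all $t\in G$ with $\sup_{x\in G}|\eta(\{t+x\})-\eta(\{x\})|<\varepsilon$ is relatively dense. It is *norm-almost periodic* if $\sup_{s\in G}\eta(s+K)<\infty$ and, for every $\varepsilon>0$, the set of all $t\in G$ with $\sup_{s\in G}|\eta-T_t\eta|(s+K)<\varepsilon$ is relatively dense. It is *strongly almost periodic* if $\sup_{s\in G}\eta(s+K)<\infty$ and, for every continuous compactly supported $f:G\to\mathbb C$, the function $x\mapsto\int f(x-y)\,d\eta(y)$ is Bohr almost periodic (continuous, with a relatively dense set of $\varepsilon$-almost periods for every $\varepsilon>0$). -/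

import Mathlib

open scoped Pointwise Topology ENNReal
open MeasureTheory

universe u

noncomputable section

namespace AperiodicOrder

section PointSets

variable {G : Type u} [AddCommGroup G] [TopologicalSpace G]

/-- `A` is relatively dense: `A + K = G` for some compact `K`. -/
def IsRelativelyDense (A : Set G) : Prop :=
  ∃ K : Set G, IsCompact K ∧ A + K = Set.univ

/-- `A` is locally finite: it has finitely many points in every compact set. -/
def IsLocallyFinite (A : Set G) : Prop :=
  ∀ K : Set G, IsCompact K → (A ∩ K).Finite

/-- `A` has finite local complexity: `A - A` is locally finite. -/
def HasFiniteLocalComplexity (A : Set G) : Prop :=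
  IsLocallyFinite (A - A)

/-- `A` is uniformly discrete: for some neighbourhood `U` of `0`, the sets `x + U`, `x ∈ A`,
are pairwise disjoint. -/
def IsUniformlyDiscrete (A : Set G) : Prop :=
  ∃ U ∈ 𝓝 (0 : G), ∀ x ∈ A, ∀ y ∈ A, x ≠ y → Disjoint (x +ᵥ U) (y +ᵥ U)

/-- `A` is period-stable: every subgroup of `G` contained in `A - A` is a group of periods
of `A`. -/
def IsPeriodStable (A : Set G) : Prop :=
  ∀ P : AddSubgroup G, (P : Set G) ⊆ A - A → (P : Set G) + A = A

/-- (Bohr) almost periodicity of a function: `g` is continuous, and for every `ε > 0` the set of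
all `t` with `‖g - T_t g‖_∞ ≤ ε` is relatively dense. -/
def IsAlmostPeriodicFun (g : G → ℂ) : Prop :=
  Continuous g ∧
    ∀ ε : ℝ, 0 < ε → IsRelativelyDense {t : G | ∀ x : G, ‖g x - g (x - t)‖ ≤ ε}

end PointSets

section ModelSets

variable {G H : Type u} [AddCommGroup G] [TopologicalSpace G]
  [AddCommGroup H] [TopologicalSpace H]

/-- `(G × H, L)` is a cut and project scheme: `L` is a lattice in `G × H` (a discrete subgroup
which is relatively dense, equivalently which has a compact quotient), the projection to `G` is
injective on `L`, and the projection of `L` to `H` is dense. -/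
structure IsCutAndProjectScheme (L : AddSubgroup (G × H)) : Prop where
  discrete : DiscreteTopology L
  relativelyDense : IsRelativelyDense (L : Set (G × H))
  injOn_fst : Set.InjOn Prod.fst (L : Set (G × H))
  dense_snd : Dense (Prod.snd '' (L : Set (G × H)))

/-- The cut and project set of a window `W`: all `x` in the projection of `L` to `G` whose image
under the star map `x ↦ y`, `(x, y) ∈ L`, lies in `W`. -/
def cutAndProjectSet (L : AddSubgroup (G × H)) (W : Set H) : Set G :=
  {x | ∃ y ∈ W, (x, y) ∈ L}

end ModelSets

/-- `A` is a model set: it is the cut and project set, in a cut and project scheme with some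
locally compact Hausdorff abelian group `H` as internal space, of a window that is relatively
compact and has non-empty interior. -/
def IsModelSet {G : Type u} [AddCommGroup G] [TopologicalSpace G] (A : Set G) : Prop :=
  ∃ (H : Type u) (_ : AddCommGroup H) (_ : TopologicalSpace H) (_ : IsTopologicalAddGroup H)
    (_ : LocallyCompactSpace H) (_ : T2Space H) (L : AddSubgroup (G × H)) (W : Set H),
    IsCutAndProjectScheme L ∧ IsCompact (closure W) ∧ (interior W).Nonempty ∧
      A = cutAndProjectSet L W

section Measures

variable {G : Type u} [AddCommGroup G] [TopologicalSpace G] [MeasurableSpace G]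

/-- The Dirac comb `∑_{x ∈ A} δ_x`. -/
def diracComb (A : Set G) : Measure G :=
  Measure.sum fun x : A => Measure.dirac (x : G)

/-- The translate `T_t μ`, given by `(T_t μ)(B) = μ(B - t)`. -/
def translate (t : G) (μ : Measure G) : Measure G :=
  μ.map fun x => t + x

/-- The total variation `|μ - ν|` of the difference of two (locally finite) positive measures,
as the sum of the positive part and the negative part of `μ - ν`; on measures, `-` is the
truncated difference: `μ - ν` is the least measure `τ` with `μ ≤ τ + ν`. -/
def absDiff (μ ν : Measure G) : Measure G :=
  (μ - ν) + (ν - μ)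

/-- For a positive measure `μ` this is `‖μ‖_K = sup_s μ(s + K)`. -/
def windowNorm (K : Set G) (μ : Measure G) : ℝ≥0∞ :=
  ⨆ s : G, μ (s +ᵥ K)

/-- `μ` is a discrete (pure point) measure: `μ = ∑_x μ({x}) δ_x`. -/
def IsDiscreteMeasure (μ : Measure G) : Prop :=
  μ = Measure.sum fun x : G => μ {x} • Measure.dirac x

/-- Norm-almost periodicity of a positive measure: `μ` is translation bounded, and for every
`ε > 0` the set of all `t` with `‖μ - T_t μ‖_K < ε` is relatively dense. Here `K` is a compact
set with non-empty interior. -/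
def IsNormAlmostPeriodic (K : Set G) (μ : Measure G) : Prop :=
  windowNorm K μ < ∞ ∧
    ∀ ε : ℝ, 0 < ε →
      IsRelativelyDense {t : G | windowNorm K (absDiff μ (translate t μ)) < ENNReal.ofReal ε}

/-- Sup-almost periodicity of a positive measure: `μ` is discrete, and for every `ε > 0` the set
of all `t` with `sup_x |μ({t + x}) - μ({x})| < ε` is relatively dense. -/
def IsSupAlmostPeriodic (μ : Measure G) : Prop :=
  IsDiscreteMeasure μ ∧
    ∀ ε : ℝ, 0 < ε →
      IsRelativelyDense
        {t : G | ⨆ x : G, ‖μ.real {t + x} - μ.real {x}‖ₑ < ENNReal.ofReal ε}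

/-- Strong almost periodicity of a positive measure: `μ` is translation bounded, and for every
`f ∈ C_c(G)` the function `(f * μ)(x) = ∫ f(x - y) dμ(y)` is almost periodic. Here `K`, which
only serves to express translation boundedness, is a compact set with non-empty interior. -/
def IsStronglyAlmostPeriodic (K : Set G) (μ : Measure G) : Prop :=
  windowNorm K μ < ∞ ∧
    ∀ f : G → ℂ, Continuous f → HasCompactSupport f →
      IsAlmostPeriodicFun fun x => ∫ y, f (x - y) ∂μ

end Measures

end AperiodicOrder

end

/-! Finite local complexity makes `Λ` countable, so a measure `η ≤ δ_Λ` is determined by the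
function `u x = η {x}`, which has values in `[0, 1]` and vanishes off `Λ`. All three notions of
almost periodicity become statements about `u`.

From a model set to a measure: weight `x ∈ Λ` by a bump function on the window, evaluated at the
star image of `x`. By uniform continuity, every `t` whose star image is small almost preserves the
weights, and such `t` are relatively dense (`IsCutAndProjectScheme.isRelativelyDense`).

Conversely, let `p t = sup_x |u (t + x) - u x|`, a seminorm on `G`, and fix `x₀` with `u x₀ > 0`.
Almost periodicity says that all `p`-balls are relatively dense. If `p t < u x₀` then `t + x₀ ∈ Λ`,
so that ball lies in `Λ - Λ` and is locally finite. These two facts make the Hausdorff completion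
`H` of `(G, p)` locally compact and the graph of `G → H` a lattice. The kernel of `p` is a subgroup
inside `Λ - Λ`; period-stability makes it a group of periods, so that membership in `Λ` can be read
off in `H` (`isModelSet_of_seminorm`).

Sup and norm almost periodicity agree because translates of `K` contain boundedly many points of
`Λ`. The same bound turns sup almost periods into almost periods of `f * η`. The way back uses
uniform discreteness of `Λ - Λ` to move an almost period of `f * η`, for a narrow bump `f`, to a
nearby element of `Λ - Λ` (`IsStronglyAlmostPeriodic.isSupAlmostPeriodic`). -/

namespace AperiodicOrder

/-! ### Locally finite, uniformly discrete and relatively dense sets -/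

section PointSets

theorem IsLocallyFinite.mono {G : Type*} [TopologicalSpace G] {A B : Set G}
    (hB : IsLocallyFinite B) (h : A ⊆ B) : IsLocallyFinite A :=
  fun K hK => (hB K hK).subset (Set.inter_subset_inter_left K h)

theorem IsLocallyFinite.countable {G : Type*} [TopologicalSpace G] [SigmaCompactSpace G]
    {A : Set G} (hA : IsLocallyFinite A) : A.Countable := by
  have : A = ⋃ n, A ∩ compactCovering G n := by
    rw [← Set.inter_iUnion, iUnion_compactCovering, Set.inter_univ]
  rw [this]
  exact Set.countable_iUnion fun n => (hA _ (isCompact_compactCovering G n)).countable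

theorem IsLocallyFinite.exists_nhds_zero {G : Type*} [AddCommGroup G] [TopologicalSpace G]
    [T2Space G] [LocallyCompactSpace G] {A : Set G}
    (hA : IsLocallyFinite A) : ∃ N ∈ 𝓝 (0 : G), ∀ x ∈ A, x ∈ N → x = 0 := by
  obtain ⟨C, hC, hC0⟩ := exists_compact_mem_nhds (0 : G)
  have hfin : ((A ∩ C) \ {0}).Finite := (hA C hC).subset Set.sdiff_subset
  refine ⟨C ∩ ((A ∩ C) \ {0})ᶜ,
    Filter.inter_mem hC0 (hfin.isClosed.isOpen_compl.mem_nhds (by simp)), ?_⟩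
  rintro x hx ⟨hxC, hxn⟩
  by_contra h0
  exact hxn ⟨⟨hx, hxC⟩, h0⟩

variable {G : Type*} [AddCommGroup G] [TopologicalSpace G]

theorem IsRelativelyDense.mono {A B : Set G} (hA : IsRelativelyDense A) (h : A ⊆ B) :
    IsRelativelyDense B := by
  obtain ⟨K, hK, hAK⟩ := hA
  exact ⟨K, hK, Set.eq_univ_of_univ_subset (hAK ▸ Set.add_subset_add_right h)⟩

theorem IsRelativelyDense.exists_decomp {A : Set G} (hA : IsRelativelyDense A) :
    ∃ K : Set G, IsCompact K ∧ ∀ g, ∃ a ∈ A, ∃ c ∈ K, g = a + c := by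
  obtain ⟨K, hK, hAK⟩ := hA
  refine ⟨K, hK, fun g => ?_⟩
  obtain ⟨a, ha, c, hc, h⟩ := Set.mem_add.1 (hAK ▸ Set.mem_univ g)
  exact ⟨a, ha, c, hc, h.symm⟩

theorem IsRelativelyDense.of_decomp {A K : Set G} (hK : IsCompact K)
    (h : ∀ g, ∃ a ∈ A, g - a ∈ K) : IsRelativelyDense A := by
  refine ⟨K, hK, Set.eq_univ_of_forall fun g => ?_⟩
  obtain ⟨a, ha, hc⟩ := h g
  exact Set.mem_add.2 ⟨a, ha, g - a, hc, by abel⟩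

variable [IsTopologicalAddGroup G]

theorem isCompact_sub {K C : Set G} (hK : IsCompact K) (hC : IsCompact C) :
    IsCompact (K - C) := by
  simpa [sub_eq_add_neg] using hK.add hC.neg

theorem HasFiniteLocalComplexity.isLocallyFinite {A : Set G} (hA : HasFiniteLocalComplexity A) :
    IsLocallyFinite A := by
  intro K hK
  rcases A.eq_empty_or_nonempty with rfl | ⟨a, ha⟩
  · simp
  · refine ((hA _ (hK.image (continuous_sub_right a))).image (· + a)).subset ?_
    rintro x ⟨hx, hxK⟩
    exact ⟨x - a, ⟨Set.sub_mem_sub hx ha, x, hxK, rfl⟩, by simp⟩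

/-- A set of finite local complexity has boundedly many points in the translates of a
compact set. -/
theorem HasFiniteLocalComplexity.exists_encard_le {A K : Set G}
    (hA : HasFiniteLocalComplexity A) (hK : IsCompact K) :
    ∃ N : ℕ, ∀ s : G, (A ∩ (s +ᵥ K)).encard ≤ N := by
  have hF := hA (K - K) (isCompact_sub hK hK)
  refine ⟨((A - A) ∩ (K - K)).ncard, fun s => ?_⟩
  rw [hF.cast_ncard_eq]
  rcases (A ∩ (s +ᵥ K)).eq_empty_or_nonempty with h | ⟨a, ha, k, hk, rfl⟩
  · simp [h]
  -- Subtracting one point of the window injects the others into `(A - A) ∩ (K - K)`, whatever `s`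
  -- is.
  · rw [← (sub_left_injective (b := s + k)).injOn.encard_image]
    refine Set.encard_le_encard ?_
    rintro _ ⟨x, ⟨hx, l, hl, rfl⟩, rfl⟩
    refine ⟨Set.sub_mem_sub hx ha, ?_⟩
    have : (s + l) - (s + k) = l - k := by abel
    simpa [this] using Set.sub_mem_sub hl hk

theorem IsUniformlyDiscrete.isLocallyFinite {A : Set G} (hA : IsUniformlyDiscrete A) :
    IsLocallyFinite A := by
  obtain ⟨U, hU, hd⟩ := hA
  intro K hK
  have hU' : ∀ g : G, {x | g - x ∈ U} ∈ 𝓝 g := fun g =>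
    (continuous_const.sub continuous_id).continuousAt.preimage_mem_nhds (by simpa using hU)
  obtain ⟨t, -, ht⟩ := hK.elim_nhds_subcover (fun g => {x | g - x ∈ U}) fun g _ => hU' g
  have : A ∩ K ⊆ ⋃ g ∈ t, A ∩ {x | g - x ∈ U} := by
    rintro x ⟨hx, hxK⟩
    obtain ⟨g, hg, hgx⟩ := Set.mem_iUnion₂.1 (ht hxK)
    exact Set.mem_iUnion₂.2 ⟨g, hg, hx, hgx⟩
  refine (t.finite_toSet.biUnion fun g _ => Set.Subsingleton.finite ?_).subset this
  rintro x ⟨hx, hxU⟩ y ⟨hy, hyU⟩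
  by_contra hne
  exact Set.disjoint_left.1 (hd x hx y hy hne) (show g ∈ _ from
    ⟨g - x, hxU, by simp⟩) ⟨g - y, hyU, by simp⟩

/-- The form in which uniform discreteness is applied: at most one point of `A` is `V`-close to a
given `g`. -/
theorem IsUniformlyDiscrete.exists_nhds_sub {A : Set G} (hA : IsUniformlyDiscrete A) :
    ∃ V ∈ 𝓝 (0 : G), ∀ x ∈ A, ∀ y ∈ A, ∀ g, x - g ∈ V → y - g ∈ V → x = y := by
  obtain ⟨U, hU, hd⟩ := hA
  refine ⟨-U, neg_mem_nhds_zero _ hU, fun x hx y hy g hxg hyg => ?_⟩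
  by_contra hne
  exact Set.disjoint_left.1 (hd x hx y hy hne) (show g ∈ _ from
    ⟨g - x, by simpa using hxg, by simp⟩) ⟨g - y, by simpa using hyg, by simp⟩

theorem HasFiniteLocalComplexity.isUniformlyDiscrete [T2Space G] [LocallyCompactSpace G]
    {A : Set G} (hA : HasFiniteLocalComplexity A) : IsUniformlyDiscrete A := by
  obtain ⟨N, hN, h⟩ := IsLocallyFinite.exists_nhds_zero hA
  have ht : Filter.Tendsto (fun p : G × G => p.1 - p.2) (𝓝 (0, 0)) (𝓝 0) := by
    simpa using (continuous_sub (G := G)).tendsto (0, 0)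
  rw [nhds_prod_eq] at ht
  obtain ⟨U, hU, hUN⟩ := Filter.mem_prod_same_iff.1 (ht hN)
  refine ⟨U, hU, fun x hx y hy hne => Set.disjoint_left.2 ?_⟩
  rintro _ ⟨u, hu, rfl⟩ ⟨v, hv, hvu⟩
  have e : x - y = v - u := by
    simp only [vadd_eq_add] at hvu
    rw [sub_eq_sub_iff_add_eq_add, ← hvu, add_comm]
  exact hne (sub_eq_zero.1 (h _ (Set.sub_mem_sub hx hy) (e ▸ hUN (Set.mk_mem_prod hv hu))))

/-- A compactly supported continuous function on a topological group is uniformly continuous. -/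
theorem exists_nhds_norm_sub_lt {E : Type*} [NormedAddCommGroup E] {f : G → E}
    (hf : Continuous f) (hs : HasCompactSupport f) {ε : ℝ} (hε : 0 < ε) :
    ∃ V ∈ 𝓝 (0 : G), ∀ x y, y - x ∈ V → ‖f x - f y‖ < ε := by
  let := IsTopologicalAddGroup.rightUniformSpace G
  have hu := HasCompactSupport.uniformContinuous_of_continuous hs hf
  have hm := hu (Metric.dist_mem_uniformity hε)
  obtain ⟨V, hV, hVs⟩ := Filter.mem_comap.1 hm
  refine ⟨V, hV, fun x y hxy => ?_⟩
  have := hVs (show (x, y) ∈ _ from by simpa [sub_eq_add_neg] using hxy)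
  simpa [dist_eq_norm] using this

/-- The points of `A` seen by `y ↦ f (x - y)` lie in a finite set of bounded cardinality. -/
theorem HasFiniteLocalComplexity.exists_finset_support {A : Set G} (hA : HasFiniteLocalComplexity A)
    {f : G → ℂ} (hf : HasCompactSupport f) :
    ∃ N : ℕ, ∀ x : G, ∃ S : Finset G, S.card ≤ N ∧ ∀ y ∈ A, f (x - y) ≠ 0 → y ∈ S := by
  obtain ⟨N, hN⟩ := hA.exists_encard_le (K := -tsupport f) (IsCompact.neg hf)
  refine ⟨N, fun x => ?_⟩
  have hfin : (A ∩ (x +ᵥ (-tsupport f))).Finite :=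
    Set.finite_of_encard_le_coe (hN x)
  refine ⟨hfin.toFinset, ?_, fun y hy hxy => hfin.mem_toFinset.2 ⟨hy, y - x, ?_, by simp⟩⟩
  · have := hN x
    rw [hfin.encard_eq_coe_toFinset_card] at this
    exact_mod_cast this
  · simpa using subset_tsupport f hxy

theorem exists_bump [T2Space G] [LocallyCompactSpace G] {V : Set G} (hV : V ∈ 𝓝 (0 : G)) :
    ∃ f : G → ℝ, Continuous f ∧ HasCompactSupport f ∧ f 0 = 1 ∧ (∀ x, 0 ≤ f x) ∧
      (∀ x, f x ≤ 1) ∧ ∀ x, f x ≠ 0 → x ∈ V := by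
  obtain ⟨f, h1, h0, hs, h01⟩ := exists_continuous_one_zero_of_isCompact
    (isCompact_singleton (x := (0 : G))) (isOpen_interior (s := V)).isClosed_compl
    (Set.disjoint_singleton_left.2 (by simpa [mem_interior_iff_mem_nhds] using hV))
  refine ⟨f, f.continuous, hs, h1 rfl, fun x => (h01 x).1, fun x => (h01 x).2, fun x hx => ?_⟩
  by_contra h
  exact hx (h0 fun h' => h (interior_subset h'))

end PointSets

/-! ### Point sets of cut and project schemes -/

section ModelSets

variable {G H : Type u} [AddCommGroup G] [AddCommGroup H] {L : AddSubgroup (G × H)}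

theorem cutAndProjectSet_mono {V W : Set H} (h : V ⊆ W) :
    cutAndProjectSet L V ⊆ cutAndProjectSet L W :=
  fun _ ⟨y, hy, hxy⟩ => ⟨y, h hy, hxy⟩

theorem cutAndProjectSet_sub_subset (V W : Set H) :
    cutAndProjectSet L V - cutAndProjectSet L W ⊆ cutAndProjectSet L (V - W) := by
  rintro _ ⟨x, ⟨y, hy, hxy⟩, x', ⟨y', hy', hxy'⟩, rfl⟩
  exact ⟨y - y', Set.sub_mem_sub hy hy', L.sub_mem hxy hxy'⟩

variable [TopologicalSpace G] [IsTopologicalAddGroup G] [TopologicalSpace H]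
  [IsTopologicalAddGroup H]

/-- Writing `(g, 0) = l + c` with `c` in a compact set puts `l.2 = -c.2` in a compact set. By
density of the projection to `H`, finitely many lattice vectors suffice to correct `l.2` into `V`,
and they shift `l.1` by a bounded amount only. -/
theorem IsCutAndProjectScheme.isRelativelyDense (hL : IsCutAndProjectScheme L) {V : Set H}
    (hV : V ∈ 𝓝 (0 : H)) : IsRelativelyDense (cutAndProjectSet L V) := by
  obtain ⟨C, hC, hLC⟩ := hL.relativelyDense.exists_decomp
  have hden : ∀ h : H, ∃ f ∈ L, {z | f.2 - z ∈ V} ∈ 𝓝 h := by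
    intro h
    obtain ⟨O, hOV, hO, h0⟩ := mem_nhds_iff.1 hV
    obtain ⟨_, hz, f, hf, rfl⟩ := hL.dense_snd.inter_open_nonempty {z | z - h ∈ O}
      (hO.preimage (continuous_sub_right h)) ⟨h, by simpa using h0⟩
    refine ⟨f, hf, Filter.mem_of_superset ?_ (fun z hz => hOV hz)⟩
    exact (hO.preimage (continuous_const.sub continuous_id)).mem_nhds hz
  choose f hfL hf using hden
  obtain ⟨t, -, ht⟩ := (hC.image continuous_snd).elim_nhds_subcover _ fun h _ => hf h
  refine IsRelativelyDense.of_decomp (K := Prod.fst '' C - (fun h => (f h).1) '' t)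
    (isCompact_sub (hC.image continuous_fst) (t.finite_toSet.image _).isCompact) fun g => ?_
  obtain ⟨l, hl, c, hc, hlc⟩ := hLC (g, 0)
  obtain ⟨h, hht, hh⟩ := Set.mem_iUnion₂.1 (ht (Set.mem_image_of_mem Prod.snd hc))
  have h1 : g = l.1 + c.1 := congrArg Prod.fst hlc
  have h2 : 0 = l.2 + c.2 := congrArg Prod.snd hlc
  refine ⟨l.1 + (f h).1, ⟨l.2 + (f h).2, ?_, L.add_mem hl (hfL h)⟩, ?_⟩
  · have : l.2 + (f h).2 = (f h).2 - c.2 := by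
      rw [eq_neg_of_add_eq_zero_left h2.symm]; abel
    rw [this]; exact hh
  · have : g - (l.1 + (f h).1) = c.1 - (f h).1 := by rw [h1]; abel
    rw [this]
    exact Set.sub_mem_sub (Set.mem_image_of_mem _ hc) (Set.mem_image_of_mem _ hht)

variable [T2Space G] [T2Space H]

theorem IsCutAndProjectScheme.isLocallyFinite (hL : IsCutAndProjectScheme L) {W : Set H}
    (hW : IsCompact W) : IsLocallyFinite (cutAndProjectSet L W) := by
  intro K hK
  have := hL.discrete
  have hc : IsClosed (L : Set (G × H)) := AddSubgroup.isClosed_of_discrete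
  have hd : IsDiscrete (L : Set (G × H)) := isDiscrete_iff_discreteTopology.2 hL.discrete
  have hfin : ((L : Set (G × H)) ∩ K ×ˢ W).Finite :=
    ((hK.prod hW).inter_left hc).finite (hd.mono Set.inter_subset_left)
  refine (hfin.image Prod.fst).subset ?_
  rintro x ⟨⟨y, hy, hxy⟩, hx⟩
  exact ⟨(x, y), ⟨hxy, hx, hy⟩, rfl⟩

theorem IsModelSet.hasFiniteLocalComplexity {A : Set G} (hA : IsModelSet A) :
    HasFiniteLocalComplexity A := by
  obtain ⟨H, _, _, _, _, _, L, W, hL, hW, -, rfl⟩ := hA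
  exact (hL.isLocallyFinite (isCompact_sub hW hW)).mono ((cutAndProjectSet_sub_subset W W).trans
    (cutAndProjectSet_mono (Set.sub_subset_sub subset_closure subset_closure)))

/-- Even `(A - A) - (A - A)` projects from a compact window, so `A - A` itself has finite local
complexity. -/
theorem IsModelSet.isUniformlyDiscrete_sub [LocallyCompactSpace G] {A : Set G}
    (hA : IsModelSet A) : IsUniformlyDiscrete (A - A) := by
  obtain ⟨H, _, _, _, _, _, L, W, hL, hW, -, rfl⟩ := hA
  refine HasFiniteLocalComplexity.isUniformlyDiscrete ?_
  refine (hL.isLocallyFinite (isCompact_sub (isCompact_sub hW hW) (isCompact_sub hW hW))).mono ?_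
  have h1 : cutAndProjectSet L W - cutAndProjectSet L W ⊆
      cutAndProjectSet L (closure W - closure W) := (cutAndProjectSet_sub_subset W W).trans
    (cutAndProjectSet_mono (Set.sub_subset_sub subset_closure subset_closure))
  exact (Set.sub_subset_sub h1 h1).trans (cutAndProjectSet_sub_subset _ _)

end ModelSets

/-! ### Measures carried by a countable set, and their atoms -/

section Atoms

theorem measure_singleton_le_windowNorm {G : Type*} [AddCommGroup G] [MeasurableSpace G]
    {K : Set G} (hK : K.Nonempty) (μ : Measure G) (x : G) :
    μ {x} ≤ windowNorm K μ := by
  obtain ⟨k, hk⟩ := hK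
  refine le_trans (measure_mono (Set.singleton_subset_iff.2 (Set.mem_vadd_set.2 ⟨k, hk, by simp⟩)))
    (le_iSup (fun s : G => μ (s +ᵥ K)) (x - k))

theorem iSup_enorm_lt_of_forall_le {G : Type*} {u : G → ℝ} {δ ε : ℝ} (hε : 0 < ε) (hδ : δ < ε)
    (h : ∀ x, |u x| ≤ δ) : ⨆ x, ‖u x‖ₑ < ENNReal.ofReal ε := by
  refine lt_of_le_of_lt (iSup_le fun x => ?_) ((ENNReal.ofReal_lt_ofReal_iff hε).2 hδ)
  rw [Real.enorm_eq_ofReal_abs]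
  exact ENNReal.ofReal_le_ofReal (h x)

theorem abs_lt_of_iSup_enorm_lt {G : Type*} {u : G → ℝ} {ε : ℝ} (h : ⨆ x, ‖u x‖ₑ < ENNReal.ofReal ε)
    (x : G) : |u x| < ε := by
  have := (le_iSup (fun x => ‖u x‖ₑ) x).trans_lt h
  rw [Real.enorm_eq_ofReal_abs] at this
  exact (ENNReal.ofReal_lt_ofReal_iff').1 this |>.1

theorem windowNorm_mono {G : Type*} [AddCommGroup G] [MeasurableSpace G]
    {K : Set G} {μ ν : Measure G} (h : μ ≤ ν) :
    windowNorm K μ ≤ windowNorm K ν :=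
  iSup_mono fun _ => h _

theorem diracComb_apply {G : Type*} [MeasurableSpace G] (A : Set G) {B : Set G}
    (hB : MeasurableSet B) :
    diracComb A B = ((A ∩ B).encard : ℝ≥0∞) := by
  rw [diracComb, Measure.sum_apply _ hB, ← ENNReal.tsum_set_one,
    tsum_subtype (A ∩ B) (fun _ => (1 : ℝ≥0∞)),
    tsum_subtype A (fun x => Measure.dirac x B)]
  refine tsum_congr fun x => ?_
  by_cases hx : x ∈ A <;> by_cases hxB : x ∈ B <;> simp [hx, hxB, hB]

variable {G : Type*} [MeasurableSpace G] [MeasurableSingletonClass G]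

theorem measure_eq_tsum_singleton {μ : Measure G} {A : Set G} (hA : A.Countable)
    (hμ : μ Aᶜ = 0) (B : Set G) : μ B = ∑' x : ↥(B ∩ A), μ {(x : G)} := by
  rw [← measure_inter_conull hμ, ← measure_biUnion (hA.mono Set.inter_subset_right)
    (fun x _ y _ hxy => Set.disjoint_singleton.2 hxy) (fun x _ => measurableSet_singleton x),
    Set.biUnion_of_singleton]

/-- A measure concentrated on a countable set is dominated by every measure with larger atoms. -/
theorem measure_le_of_singleton_le {μ ν : Measure G} {A : Set G} (hA : A.Countable)
    (hμ : μ Aᶜ = 0) (h : ∀ x ∈ A, μ {x} ≤ ν {x}) : μ ≤ ν := by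
  refine Measure.le_iff.2 fun B _ => ?_
  rw [measure_eq_tsum_singleton hA hμ B]
  calc ∑' x : ↥(B ∩ A), μ {(x : G)} ≤ ∑' x : ↥(B ∩ A), ν {(x : G)} :=
        ENNReal.tsum_le_tsum fun x => h x x.2.2
    _ = ν (B ∩ A) := by
        rw [← measure_biUnion (hA.mono Set.inter_subset_right)
          (fun x _ y _ hxy => Set.disjoint_singleton.2 hxy)
          (fun x _ => measurableSet_singleton x), Set.biUnion_of_singleton]
    _ ≤ ν B := measure_mono Set.inter_subset_left

theorem sum_smul_dirac_singleton (u : G → ℝ≥0∞) (x : G) :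
    Measure.sum (fun y : G => u y • Measure.dirac y) {x} = u x := by
  rw [Measure.sum_apply _ (measurableSet_singleton x), tsum_eq_single x]
  · simp
  · intro y hy
    simp [hy]

theorem sum_smul_dirac_compl {u : G → ℝ≥0∞} {A : Set G} (hA : A.Countable)
    (hu : ∀ x ∉ A, u x = 0) : Measure.sum (fun y : G => u y • Measure.dirac y) Aᶜ = 0 := by
  rw [Measure.sum_apply _ hA.measurableSet.compl, ENNReal.tsum_eq_zero]
  intro y
  by_cases hy : y ∈ A
  · simp [hy, hA.measurableSet.compl]
  · simp [hu y hy]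

theorem isDiscreteMeasure_of_countable {μ : Measure G} {A : Set G} (hA : A.Countable)
    (hμ : μ Aᶜ = 0) : IsDiscreteMeasure μ := by
  have h0 : ∀ x ∉ A, μ {x} = 0 := fun x hx =>
    measure_mono_null (Set.singleton_subset_iff.2 hx) hμ
  refine le_antisymm ?_ ?_
  · exact measure_le_of_singleton_le hA hμ fun x _ => (sum_smul_dirac_singleton _ x).ge
  · exact measure_le_of_singleton_le hA (sum_smul_dirac_compl hA h0)
      fun x _ => (sum_smul_dirac_singleton _ x).le

theorem diracComb_singleton_le_one (A : Set G) (x : G) : diracComb A {x} ≤ 1 := by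
  rw [diracComb_apply A (measurableSet_singleton x)]
  have : (A ∩ {x}).encard ≤ 1 :=
    (Set.encard_le_encard Set.inter_subset_right).trans (Set.encard_singleton x).le
  exact_mod_cast this

theorem diracComb_singleton {A : Set G} {x : G} (hx : x ∈ A) : diracComb A {x} = 1 := by
  rw [diracComb_apply A (measurableSet_singleton x),
    Set.inter_eq_right.2 (Set.singleton_subset_iff.2 hx)]
  simp

theorem diracComb_compl {A : Set G} (hA : A.Countable) : diracComb A Aᶜ = 0 := by
  rw [diracComb_apply A hA.measurableSet.compl]
  simp

section Dominated

variable {A : Set G} {η : Measure G}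

theorem measure_compl_eq_zero_of_le_diracComb (hA : A.Countable) (hη : η ≤ diracComb A) :
    η Aᶜ = 0 :=
  le_antisymm ((hη _).trans (diracComb_compl hA).le) zero_le

theorem singleton_ne_top_of_le_diracComb (hη : η ≤ diracComb A) (x : G) : η {x} ≠ ∞ :=
  ((hη _).trans (diracComb_singleton_le_one A x)).trans_lt ENNReal.one_lt_top |>.ne

theorem real_singleton_le_one (hη : η ≤ diracComb A) (x : G) : η.real {x} ≤ 1 :=
  ENNReal.toReal_le_of_le_ofReal zero_le_one
    (by simpa using (hη _).trans (diracComb_singleton_le_one A x))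

theorem real_singleton_eq_zero (hA : A.Countable) (hη : η ≤ diracComb A) {x : G} (hx : x ∉ A) :
    η.real {x} = 0 := by
  rw [measureReal_def, measure_mono_null (Set.singleton_subset_iff.2 hx)
    (measure_compl_eq_zero_of_le_diracComb hA hη), ENNReal.toReal_zero]

theorem mem_of_real_singleton_pos (hA : A.Countable) (hη : η ≤ diracComb A) {x : G}
    (hx : 0 < η.real {x}) : x ∈ A := by
  by_contra h
  exact hx.ne' (real_singleton_eq_zero hA hη h)

theorem exists_real_singleton_pos (hA : A.Countable) (hη : η ≤ diracComb A) (h0 : η ≠ 0) :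
    ∃ x, 0 < η.real {x} := by
  by_contra! h
  refine h0 (le_antisymm (measure_le_of_singleton_le hA
    (measure_compl_eq_zero_of_le_diracComb hA hη) fun x _ => ?_) bot_le)
  have h1 : η.real {x} = 0 := le_antisymm (h x) measureReal_nonneg
  exact ((measureReal_eq_zero_iff (singleton_ne_top_of_le_diracComb hη x)).1 h1).le.trans zero_le

theorem integral_eq_sum_singleton (hA : A.Countable) (hη : η ≤ diracComb A) (f : G → ℂ)
    (S : Finset G) (hS : ∀ y ∈ A, f y ≠ 0 → y ∈ S) :
    ∫ y, f y ∂η = ∑ y ∈ S, η.real {y} • f y := by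
  have hae : f =ᵐ[η] (S : Set G).indicator f := by
    have : ∀ᵐ y ∂η, y ∈ A :=
      measure_eq_zero_iff_ae_notMem.1 (measure_compl_eq_zero_of_le_diracComb hA hη)
        |>.mono fun y hy => not_not.1 hy
    filter_upwards [this] with y hy
    by_cases h : y ∈ (S : Set G)
    · simp [h]
    · rw [Set.indicator_of_notMem h]
      by_contra h0
      exact h (hS y hy h0)
  have hint : IntegrableOn f S η := by
    rw [← (S : Set G).biUnion_of_singleton]
    simp [integrableOn_finset_iUnion, (singleton_ne_top_of_le_diracComb hη _).lt_top]
  rw [integral_congr_ae hae, integral_indicator S.measurableSet, setIntegral_finset S hint]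

end Dominated

/-- The measure with prescribed atoms of mass at most one on a countable set. -/
theorem exists_measure_le_diracComb {A : Set G} (hA : A.Countable) {u : G → ℝ}
    (hu0 : ∀ x, 0 ≤ u x) (hu1 : ∀ x, u x ≤ 1) (hu : ∀ x ∉ A, u x = 0) :
    ∃ η : Measure G, η ≤ diracComb A ∧ ∀ x, η.real {x} = u x := by
  refine ⟨Measure.sum fun x => ENNReal.ofReal (u x) • Measure.dirac x, ?_, fun x => ?_⟩
  · refine measure_le_of_singleton_le hA
      (sum_smul_dirac_compl hA fun x hx => by simp [hu x hx]) fun x hx => ?_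
    rw [sum_smul_dirac_singleton, diracComb_singleton hx]
    exact ENNReal.ofReal_le_one.2 (hu1 x)
  · rw [measureReal_def, sum_smul_dirac_singleton, ENNReal.toReal_ofReal (hu0 x)]

theorem singleton_sub_le_sub_singleton {μ ν : Measure G} {x : G} (hν : ν {x} ≠ ∞) :
    μ {x} - ν {x} ≤ (μ - ν) {x} := by
  rcases le_total (μ {x}) (ν {x}) with h | h
  · simp [tsub_eq_zero_of_le h]
  -- The pointwise formula for a difference of measures needs a finite, smaller subtrahend;
  -- restricting to the atom provides both.
  · have : IsFiniteMeasure (ν.restrict {x}) := ⟨by simpa using hν.lt_top⟩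
    have hle : ν.restrict {x} ≤ μ.restrict {x} := by
      rw [Measure.restrict_singleton, Measure.restrict_singleton]
      refine Measure.le_iff.2 fun s _ => ?_
      simp only [Measure.smul_apply, smul_eq_mul]
      gcongr
    rw [← Measure.restrict_apply_self (μ - ν) {x},
      Measure.restrict_sub_eq_restrict_sub_restrict (measurableSet_singleton x),
      Measure.sub_apply (measurableSet_singleton x) hle, Measure.restrict_apply_self,
      Measure.restrict_apply_self]

theorem enorm_sub_le_absDiff_singleton {μ ν : Measure G} {x : G} (hμ : μ {x} ≠ ∞)
    (hν : ν {x} ≠ ∞) : ‖μ.real {x} - ν.real {x}‖ₑ ≤ absDiff μ ν {x} := by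
  rw [absDiff, Measure.add_apply, Real.enorm_eq_ofReal_abs]
  rcases le_total (ν.real {x}) (μ.real {x}) with h | h
  · rw [abs_of_nonneg (sub_nonneg.2 h), ENNReal.ofReal_sub _ measureReal_nonneg,
      ofReal_measureReal hμ, ofReal_measureReal hν]
    exact (singleton_sub_le_sub_singleton hν).trans le_self_add
  · rw [abs_sub_comm, abs_of_nonneg (sub_nonneg.2 h), ENNReal.ofReal_sub _ measureReal_nonneg,
      ofReal_measureReal hμ, ofReal_measureReal hν]
    exact (singleton_sub_le_sub_singleton hμ).trans le_add_self

end Atoms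

/-! ### Sup versus norm almost periodicity -/

section Translates

theorem isSupAlmostPeriodic_iff {G : Type*} [AddCommGroup G] [TopologicalSpace G] [T2Space G]
    [MeasurableSpace G] [BorelSpace G] {A : Set G} (hA : A.Countable) {η : Measure G}
    (hη : η ≤ diracComb A) :
    IsSupAlmostPeriodic η ↔ ∀ ε : ℝ, 0 < ε →
      IsRelativelyDense {t : G | ∀ x, |η.real {t + x} - η.real {x}| ≤ ε} := by
  refine ⟨fun h ε hε => (h.2 ε hε).mono fun t ht x => (abs_lt_of_iSup_enorm_lt ht x).le,
    fun h => ⟨isDiscreteMeasure_of_countable hA (measure_compl_eq_zero_of_le_diracComb hA hη),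
      fun ε hε => (h (ε / 2) (half_pos hε)).mono fun t ht =>
        iSup_enorm_lt_of_forall_le hε (half_lt_self hε) ht⟩⟩

variable {G : Type*} [AddCommGroup G] [TopologicalSpace G] [IsTopologicalAddGroup G]
  [MeasurableSpace G] [BorelSpace G]

theorem translate_apply (t : G) (μ : Measure G) (B : Set G) :
    translate t μ B = μ ((fun x => t + x) ⁻¹' B) :=
  (Homeomorph.addLeft t).measurableEmbedding.map_apply μ B

theorem translate_apply_singleton (t : G) (μ : Measure G) (x : G) :
    translate t μ {x} = μ {x - t} := by
  rw [translate_apply]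
  congr 1
  ext y
  rw [Set.mem_preimage, Set.mem_singleton_iff, Set.mem_singleton_iff, eq_sub_iff_add_eq, add_comm]

theorem real_translate_singleton (t : G) (μ : Measure G) (x : G) :
    (translate t μ).real {x} = μ.real {x - t} := by
  rw [measureReal_def, translate_apply_singleton, measureReal_def]

theorem windowNorm_translate_le (K : Set G) (t : G) (μ : Measure G) :
    windowNorm K (translate t μ) ≤ windowNorm K μ := by
  refine iSup_le fun s => ?_
  rw [translate_apply]
  refine le_trans (measure_mono ?_) (le_iSup (fun s : G => μ (s +ᵥ K)) (s - t))
  rintro x ⟨k, hk, hx⟩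
  refine ⟨k, hk, ?_⟩
  simp only [vadd_eq_add] at hx ⊢
  rw [sub_add_eq_add_sub, hx, add_sub_cancel_left]

variable [T2Space G]

theorem windowNorm_diracComb_le {A K : Set G} (hA : HasFiniteLocalComplexity A)
    (hK : IsCompact K) : ∃ N : ℕ, windowNorm K (diracComb A) ≤ N := by
  obtain ⟨N, hN⟩ := hA.exists_encard_le hK
  refine ⟨N, iSup_le fun s => ?_⟩
  rw [diracComb_apply A (hK.vadd s).measurableSet]
  exact_mod_cast hN s

/-- The positive part of the difference lives on `A`, the negative part on `t + A`, and all their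
atoms are at most `ε`. -/
theorem absDiff_translate_le {A : Set G} (hA : A.Countable) {η : Measure G}
    (hη : η ≤ diracComb A) {t : G} {ε : ℝ} (h : ∀ x, |η.real {t + x} - η.real {x}| ≤ ε) :
    absDiff η (translate t η) ≤
      ENNReal.ofReal ε • diracComb A + ENNReal.ofReal ε • translate t (diracComb A) := by
  have htop := singleton_ne_top_of_le_diracComb hη
  have hε : 0 ≤ ε := (abs_nonneg _).trans (h 0)
  have key : ∀ x y, η.real {x} ≤ ε + η.real {y} → η {x} ≤ ENNReal.ofReal ε + η {y} := by
    intro x y hxy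
    rw [← ofReal_measureReal (htop x), ← ofReal_measureReal (htop y),
      ← ENNReal.ofReal_add hε measureReal_nonneg]
    exact ENNReal.ofReal_le_ofReal hxy
  refine add_le_add (Measure.sub_le_of_le_add ?_) (Measure.sub_le_of_le_add ?_)
  · refine measure_le_of_singleton_le hA (measure_compl_eq_zero_of_le_diracComb hA hη)
      fun x hx => ?_
    rw [Measure.add_apply, Measure.smul_apply, diracComb_singleton hx,
      translate_apply_singleton, smul_eq_mul, mul_one]
    refine key _ _ ?_
    have := abs_le.1 (h (x - t))
    rw [add_sub_cancel] at this
    linarith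
  · have hc : (translate t η) ((fun x => x - t) ⁻¹' A)ᶜ = 0 := by
      rw [translate_apply]
      refine measure_mono_null ?_ (measure_compl_eq_zero_of_le_diracComb hA hη)
      intro x hx
      simpa using hx
    refine measure_le_of_singleton_le (hA.preimage sub_left_injective) hc fun x hx => ?_
    rw [Measure.add_apply, Measure.smul_apply, translate_apply_singleton,
      translate_apply_singleton, diracComb_singleton (show x - t ∈ A from hx), smul_eq_mul, mul_one]
    refine key _ _ ?_
    have := abs_le.1 (h (x - t))
    rw [add_sub_cancel] at this
    linarith

theorem isNormAlmostPeriodic_iff_isSupAlmostPeriodic {A K : Set G} (hA : A.Countable)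
    (hflc : HasFiniteLocalComplexity A) (hK : IsCompact K) (hne : K.Nonempty) {η : Measure G}
    (hη : η ≤ diracComb A) : IsNormAlmostPeriodic K η ↔ IsSupAlmostPeriodic η := by
  obtain ⟨N, hN⟩ := windowNorm_diracComb_le hflc hK
  rw [isSupAlmostPeriodic_iff hA hη]
  constructor
  · intro h ε hε
    refine (h.2 ε hε).mono fun t ht x => ?_
    have htop := singleton_ne_top_of_le_diracComb hη
    have h1 : ‖η.real {t + x} - (translate t η).real {t + x}‖ₑ < ENNReal.ofReal ε :=
      ((enorm_sub_le_absDiff_singleton (htop _)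
        (by rw [translate_apply_singleton]; exact htop _)).trans
        (measure_singleton_le_windowNorm hne _ _)).trans_lt ht
    rw [real_translate_singleton, add_sub_cancel_left, Real.enorm_eq_ofReal_abs] at h1
    exact ((ENNReal.ofReal_lt_ofReal_iff').1 h1).1.le
  · intro h
    refine ⟨(windowNorm_mono hη).trans_lt (hN.trans_lt (ENNReal.natCast_lt_top N)),
      fun ε hε => ?_⟩
    -- Each of the two combs contributes at most `N` atoms per window; the `+ 1` avoids division by
    -- zero and makes the final bound strict.
    have hM : (0 : ℝ) < 2 * N + 1 := by positivity
    refine (h (ε / (2 * N + 1)) (div_pos hε hM)).mono fun t ht => ?_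
    set δ := ε / (2 * N + 1) with hδ
    have hδ0 : 0 < δ := div_pos hε hM
    calc windowNorm K (absDiff η (translate t η))
        ≤ ENNReal.ofReal δ * N + ENNReal.ofReal δ * N := by
          refine iSup_le fun s => (absDiff_translate_le hA hη ht (s +ᵥ K)).trans ?_
          simp only [Measure.add_apply, Measure.smul_apply, smul_eq_mul]
          gcongr
          · exact (le_iSup (fun s : G => diracComb A (s +ᵥ K)) s).trans hN
          · exact ((le_iSup (fun s : G => translate t (diracComb A) (s +ᵥ K)) s).trans
              (windowNorm_translate_le K t _)).trans hN
      _ = ENNReal.ofReal (δ * N + δ * N) := by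
          rw [ENNReal.ofReal_add (by positivity) (by positivity),
            ENNReal.ofReal_mul hδ0.le, ENNReal.ofReal_natCast]
      _ < ENNReal.ofReal ε := by
          refine (ENNReal.ofReal_lt_ofReal_iff hε).2 ?_
          have : δ * (2 * N + 1) = ε := div_mul_cancel₀ ε hM.ne'
          linarith

end Translates

/-! ### Sup versus strong almost periodicity -/

theorem norm_integral_sub_le {G : Type*} [TopologicalSpace G] [T2Space G] [MeasurableSpace G]
    [BorelSpace G] {A : Set G} {η : Measure G} (hA : A.Countable) (hη : η ≤ diracComb A)
    {f g : G → ℂ}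
    {S T : Finset G} (hS : ∀ y ∈ A, f y ≠ 0 → y ∈ S) (hT : ∀ y ∈ A, g y ≠ 0 → y ∈ T)
    {N : ℕ} (hSN : S.card ≤ N) (hTN : T.card ≤ N) {δ : ℝ} (hδ : 0 ≤ δ)
    (h : ∀ y, ‖f y - g y‖ ≤ δ) : ‖∫ y, f y ∂η - ∫ y, g y ∂η‖ ≤ 2 * N * δ := by
  classical
  rw [integral_eq_sum_singleton hA hη f (S ∪ T)
      fun y hy h0 => Finset.mem_union_left _ (hS y hy h0),
    integral_eq_sum_singleton hA hη g (S ∪ T)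
      fun y hy h0 => Finset.mem_union_right _ (hT y hy h0), ← Finset.sum_sub_distrib]
  calc ‖∑ y ∈ S ∪ T, (η.real {y} • f y - η.real {y} • g y)‖
      ≤ ∑ _y ∈ S ∪ T, δ := by
        refine norm_sum_le_of_le _ fun y _ => ?_
        rw [← smul_sub, norm_smul, Real.norm_of_nonneg measureReal_nonneg]
        exact (mul_le_of_le_one_left (norm_nonneg _) (real_singleton_le_one hη y)).trans (h y)
    _ = (S ∪ T).card * δ := by simp
    _ ≤ 2 * N * δ := by
        gcongr
        have : (S ∪ T).card ≤ 2 * N := (Finset.card_union_le S T).trans (by omega)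
        exact_mod_cast this

theorem norm_convolution_sub_le {G : Type*} [AddCommGroup G] [TopologicalSpace G] [T2Space G]
    [MeasurableSpace G] [BorelSpace G] {A : Set G} {η : Measure G} (hA : A.Countable)
    (hη : η ≤ diracComb A) {f : G → ℂ} {M : ℝ}
    (hM : ∀ x, ‖f x‖ ≤ M) {N : ℕ}
    (hN : ∀ x : G, ∃ S : Finset G, S.card ≤ N ∧ ∀ y ∈ A, f (x - y) ≠ 0 → y ∈ S)
    {t : G} {ε : ℝ} (ht : ∀ x, |η.real {t + x} - η.real {x}| ≤ ε) (x : G) :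
    ‖∫ y, f (x - y) ∂η - ∫ y, f (x - t - y) ∂η‖ ≤ 2 * N * (ε * M) := by
  classical
  obtain ⟨S, hSN, hS⟩ := hN x
  obtain ⟨T, hTN, hT⟩ := hN (x - t)
  have hε : 0 ≤ ε := (abs_nonneg _).trans (ht 0)
  have hM0 : 0 ≤ M := (norm_nonneg _).trans (hM 0)
  have hinj : Set.InjOn (fun z : G => z - t) ↑(S ∪ T.image (t + ·)) :=
    sub_left_injective.injOn
  -- Substituting `y = z - t` in the second integral gives both the same factor `f (x - z)`, so only
  -- the weights `η {z}` and `η {z - t}` differ.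
  rw [integral_eq_sum_singleton hA hη (fun y => f (x - y)) (S ∪ T.image (t + ·))
      fun y hy h0 => Finset.mem_union_left _ (hS y hy h0),
    integral_eq_sum_singleton hA hη (fun y => f (x - t - y))
      ((S ∪ T.image (t + ·)).image fun z => z - t) fun y hy h0 => Finset.mem_image.2
        ⟨t + y, Finset.mem_union_right _ (Finset.mem_image_of_mem _ (hT y hy h0)), by simp⟩,
    Finset.sum_image hinj, ← Finset.sum_sub_distrib]
  calc _ ≤ ∑ _z ∈ S ∪ T.image (t + ·), ε * M := by
        refine norm_sum_le_of_le _ fun z _ => ?_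
        have hz : x - t - (z - t) = x - z := by abel
        rw [hz, ← sub_smul, norm_smul]
        have := ht (z - t)
        rw [add_sub_cancel] at this
        exact mul_le_mul this (hM _) (norm_nonneg _) hε
    _ = (S ∪ T.image (t + ·)).card * (ε * M) := by simp
    _ ≤ 2 * N * (ε * M) := by
        gcongr
        have : (S ∪ T.image (t + ·)).card ≤ 2 * N := by
          have h1 := Finset.card_union_le S (T.image (t + ·))
          have h2 : (T.image (t + ·)).card ≤ T.card := Finset.card_image_le
          omega
        exact_mod_cast this

variable {G : Type*} [AddCommGroup G] [TopologicalSpace G] [IsTopologicalAddGroup G]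
  [T2Space G] [MeasurableSpace G] [BorelSpace G] {A : Set G} {η : Measure G}

theorem continuous_convolution (hA : A.Countable) (hflc : HasFiniteLocalComplexity A)
    (hη : η ≤ diracComb A) {f : G → ℂ} (hf : Continuous f) (hfs : HasCompactSupport f) :
    Continuous fun x => ∫ y, f (x - y) ∂η := by
  obtain ⟨N, hN⟩ := hflc.exists_finset_support hfs
  refine continuous_iff_continuousAt.2 fun x => Metric.tendsto_nhds.2 fun ε hε => ?_
  have hM : (0 : ℝ) < 2 * N + 1 := by positivity
  obtain ⟨V, hV, hVf⟩ := exists_nhds_norm_sub_lt hf hfs (div_pos hε hM)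
  have hVx : ∀ᶠ z in 𝓝 x, x - z ∈ V :=
    (continuous_const.sub continuous_id).continuousAt.preimage_mem_nhds (by simpa using hV)
  filter_upwards [hVx] with z hz
  obtain ⟨S, hSN, hS⟩ := hN z
  obtain ⟨T, hTN, hT⟩ := hN x
  rw [dist_eq_norm]
  refine (norm_integral_sub_le hA hη hS hT hSN hTN (div_pos hε hM).le fun y =>
    (hVf _ _ (by simpa using hz)).le).trans_lt ?_
  have : (2 * N + 1) * (ε / (2 * N + 1)) = ε := mul_div_cancel₀ ε hM.ne'
  have := div_pos hε hM
  linarith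

theorem IsSupAlmostPeriodic.isStronglyAlmostPeriodic {K : Set G} (hA : A.Countable)
    (hflc : HasFiniteLocalComplexity A) (hK : IsCompact K) (hη : η ≤ diracComb A)
    (h : IsSupAlmostPeriodic η) : IsStronglyAlmostPeriodic K η := by
  rw [isSupAlmostPeriodic_iff hA hη] at h
  obtain ⟨N₀, hN₀⟩ := windowNorm_diracComb_le hflc hK
  refine ⟨(windowNorm_mono hη).trans_lt (hN₀.trans_lt (ENNReal.natCast_lt_top _)),
    fun f hf hfs => ⟨continuous_convolution hA hflc hη hf hfs, fun ε hε => ?_⟩⟩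
  obtain ⟨N, hN⟩ := hflc.exists_finset_support hfs
  obtain ⟨M, hM⟩ := hfs.exists_bound_of_continuous hf
  have hM0 : 0 ≤ M := (norm_nonneg _).trans (hM 0)
  have hD : (0 : ℝ) < 2 * N * M + 1 := by positivity
  refine (h _ (div_pos hε hD)).mono fun t ht x => ?_
  refine (norm_convolution_sub_le hA hη hM hN ht x).trans ?_
  have := div_mul_cancel₀ ε hD.ne'
  have := div_pos hε hD
  linarith

/-- If `A - A` is uniformly discrete, the almost periods of a convolution with a narrow bump
function can be moved to almost periods of the atoms. -/
theorem IsStronglyAlmostPeriodic.isSupAlmostPeriodic [LocallyCompactSpace G] {K : Set G}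
    (hA : A.Countable) (hud : IsUniformlyDiscrete (A - A)) (hη : η ≤ diracComb A)
    (h : IsStronglyAlmostPeriodic K η) (hη0 : η ≠ 0) : IsSupAlmostPeriodic η := by
  rw [isSupAlmostPeriodic_iff hA hη]
  obtain ⟨x₀, hx₀⟩ := exists_real_singleton_pos hA hη hη0
  obtain ⟨V, hV, hVA⟩ := hud.exists_nhds_sub
  -- The support is made symmetric because differences are read with both signs. It is so small that
  -- `x - ·` meets it in at most one point `y` of `A`, whence `E x = η {y} * f (x - y)`.
  obtain ⟨f, hf, hfs, hf0, hfnn, hf1, hfV⟩ :=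
    exists_bump (Filter.inter_mem hV (neg_mem_nhds_zero G hV))
  set E : G → ℂ := fun x => ∫ y, (f (x - y) : ℂ) ∂η with hE
  have hE1 : ∀ x, ∀ y ∈ A, f (x - y) ≠ 0 → E x = (η.real {y} * f (x - y) : ℝ) := by
    intro x y hy hxy
    have : E x = ∑ z ∈ {y}, η.real {z} • (f (x - z) : ℂ) := by
      refine integral_eq_sum_singleton hA hη _ {y} fun z hz hxz => Finset.mem_singleton.2 ?_
      have hxz' : f (x - z) ≠ 0 := by simpa using hxz
      have := hVA (z - y) (Set.sub_mem_sub hz hy) (y - y) (Set.sub_mem_sub hy hy) (x - y)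
        (by simpa using (hfV _ hxz').2) (by simpa using (hfV _ hxy).2)
      exact sub_left_injective this
    rw [this, Finset.sum_singleton, Complex.real_smul, Complex.ofReal_mul]
  have hEA : ∀ y ∈ A, E y = (η.real {y} : ℝ) := by
    intro y hy
    rw [hE1 y y hy (by simp [hf0]), sub_self, hf0, mul_one]
  have hE0 : ∀ x, E x ≠ 0 → ∃ y ∈ A, f (x - y) ≠ 0 := by
    intro x hx
    by_contra! hc
    refine hx ?_
    have := integral_eq_sum_singleton hA hη (fun y => (f (x - y) : ℂ)) ∅
      fun y hy h0 => absurd (by simp [hc y hy]) h0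
    simpa using this
  intro ε hε
  -- The bound `η {x₀} / 2` keeps `E (x₀ - t)` nonzero, so a point `y₀ ∈ A` is seen from `x₀ - t`.
  -- The new almost period is `x₀ - y₀`, the only element of `A - A` that is `V`-close to `t`.
  have hap := (h.2 (fun x => (f x : ℂ)) (Complex.continuous_ofReal.comp hf)
    (hfs.comp_left (g := ((↑) : ℝ → ℂ)) Complex.ofReal_zero)).2
    (min ε (η.real {x₀} / 2)) (by positivity)
  obtain ⟨C, hC, hdec⟩ := hap.exists_decomp
  refine IsRelativelyDense.of_decomp (K := C - tsupport f) (isCompact_sub hC hfs) fun g => ?_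
  obtain ⟨t, ht, c, hc, rfl⟩ := hdec g
  have ht' : ∀ x, ‖E x - E (x - t)‖ ≤ min ε (η.real {x₀} / 2) := ht
  have htε : ∀ x, ‖E x - E (x - t)‖ ≤ ε := fun x => (ht' x).trans (min_le_left _ _)
  have hxA := mem_of_real_singleton_pos hA hη hx₀
  have hne : E (x₀ - t) ≠ 0 := by
    intro h0
    have := (ht' x₀).trans (min_le_right _ _)
    rw [h0, sub_zero, hEA x₀ hxA, Complex.norm_real,
      Real.norm_of_nonneg measureReal_nonneg] at this
    linarith
  obtain ⟨y₀, hy₀, hf₀⟩ := hE0 _ hne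
  have hp : x₀ - y₀ - t ∈ V := by
    have := (hfV _ hf₀).1
    rwa [sub_right_comm] at this
  have huniq : ∀ x ∈ A, ∀ y ∈ A, x - y - t ∈ V → x - y = x₀ - y₀ := fun x hx y hy hxy =>
    hVA _ (Set.sub_mem_sub hx hy) _ (Set.sub_mem_sub hxA hy₀) t hxy hp
  refine ⟨x₀ - y₀, fun x => ?_, ?_⟩
  · have hnn : ∀ z, 0 ≤ η.real {z} := fun z => measureReal_nonneg
    have hnear : ∀ y z, ∀ s, η.real {y} - η.real {z} * f s ≤ ‖(η.real {y} : ℂ) -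
        (η.real {z} * f s : ℝ)‖ := by
      intro y z s
      rw [← Complex.ofReal_sub, Complex.norm_real]
      exact le_abs_self _
    have hmul : ∀ z s, η.real {z} * f s ≤ η.real {z} := fun z s =>
      mul_le_of_le_one_right (hnn z) (hf1 s)
    rw [abs_le]
    constructor
    -- If `η {x}` exceeds `ε`, then `x + t` sees some `y ∈ A`, and uniqueness forces `y = x₀ - y₀ +
    -- x`. As `f ≤ 1`, the atom at `y` is at least `η {x} - ε`.
    · by_contra! hlt
      have hgt : ε < η.real {x} := by linarith [hnn (x₀ - y₀ + x)]
      have hx := mem_of_real_singleton_pos hA hη (hε.trans hgt)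
      have hd := htε (x + t)
      rw [add_sub_cancel_right, norm_sub_rev, hEA x hx] at hd
      have hne' : E (x + t) ≠ 0 := by
        intro h0
        rw [h0, sub_zero, Complex.norm_real, Real.norm_of_nonneg (hnn x)] at hd
        linarith
      obtain ⟨y, hy, hfy⟩ := hE0 _ hne'
      have hyx := huniq y hy x hx (by
        have := (hfV _ hfy).2
        rw [Set.mem_neg] at this
        convert this using 1
        abel)
      rw [hE1 _ y hy hfy] at hd
      have : y = x₀ - y₀ + x := by rw [← hyx]; abel
      have := (hnear x y (x + t - y)).trans hd
      have := hmul y (x + t - y)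
      subst y
      linarith
    · by_contra! hlt
      set z := x₀ - y₀ + x with hz
      have hgt : ε < η.real {z} := by linarith [hnn x]
      have hzA := mem_of_real_singleton_pos hA hη (hε.trans hgt)
      have hd := htε z
      rw [hEA z hzA] at hd
      have hne' : E (z - t) ≠ 0 := by
        intro h0
        rw [h0, sub_zero, Complex.norm_real, Real.norm_of_nonneg (hnn z)] at hd
        linarith
      obtain ⟨y, hy, hfy⟩ := hE0 _ hne'
      have hzy := huniq z hzA y hy (by
        have := (hfV _ hfy).1
        rwa [sub_right_comm] at this)
      rw [hE1 _ y hy hfy] at hd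
      have hyx : y = x := by
        have : y = z - (x₀ - y₀) := by rw [← hzy]; abel
        rw [this, hz]; abel
      have h1 := (hnear z y (z - t - y)).trans hd
      have h2 := hmul y (z - t - y)
      rw [hyx] at h1 h2
      linarith
  · have : t + c - (x₀ - y₀) = c - (x₀ - t - y₀) := by abel
    rw [this]
    exact Set.sub_mem_sub hc (subset_tsupport f hf₀)

/-! ### An almost periodic measure on a model set -/

section FromModelSet

variable {G : Type u} [AddCommGroup G] [TopologicalSpace G] [IsTopologicalAddGroup G]
  [T2Space G] [MeasurableSpace G] [BorelSpace G]

theorem IsModelSet.exists_isSupAlmostPeriodic {A : Set G} (hA : A.Countable)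
    (h : IsModelSet A) :
    ∃ η : Measure G, IsSupAlmostPeriodic η ∧ η ≠ 0 ∧ η ≤ diracComb A := by
  classical
  obtain ⟨H, _, _, _, _, _, L, W, hL, -, ⟨w, hw⟩, rfl⟩ := h
  have hW : {z : H | z + w ∈ W} ∈ 𝓝 (0 : H) :=
    (continuous_add_const w).continuousAt.preimage_mem_nhds
      (by simpa using mem_interior_iff_mem_nhds.1 hw)
  obtain ⟨f, hf, hfs, hf0, hfnn, hf1, hfW⟩ := exists_bump hW
  have huniq : ∀ {x y y'}, (x, y) ∈ L → (x, y') ∈ L → y = y' := fun h h' =>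
    congrArg Prod.snd (hL.injOn_fst h h' rfl)
  set u : G → ℝ := fun x => if hx : ∃ y, (x, y) ∈ L then f (hx.choose - w) else 0 with hu
  have hu1 : ∀ {x y}, (x, y) ∈ L → u x = f (y - w) := by
    intro x y hxy
    have hx : ∃ y, (x, y) ∈ L := ⟨y, hxy⟩
    simp only [hu, dif_pos hx]
    rw [huniq hx.choose_spec hxy]
  have hu0 : ∀ {x}, (¬ ∃ y, (x, y) ∈ L) → u x = 0 := fun hx => by simp only [hu, dif_neg hx]
  have hcases : ∀ {p : ℝ → Prop}, p 0 → (∀ z, p (f z)) → ∀ x, p (u x) := by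
    intro p h0 hp x
    by_cases hx : ∃ y, (x, y) ∈ L
    · obtain ⟨y, hy⟩ := hx
      rw [hu1 hy]; exact hp _
    · rw [hu0 hx]; exact h0
  obtain ⟨η, hη, hηu⟩ := exists_measure_le_diracComb hA (u := u)
    (hcases (p := fun r => 0 ≤ r) le_rfl hfnn) (hcases (p := fun r => r ≤ 1) zero_le_one hf1) (by
      intro x hx
      by_contra h0
      obtain ⟨y, hy⟩ := not_not.1 fun hn => h0 (hu0 hn)
      rw [hu1 hy] at h0
      exact hx ⟨y, by simpa using hfW _ h0, hy⟩)
  refine ⟨η, (isSupAlmostPeriodic_iff hA hη).2 fun ε hε => ?_, ?_, hη⟩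
  · obtain ⟨V, hV, hVf⟩ := exists_nhds_norm_sub_lt hf hfs hε
    refine (hL.isRelativelyDense (neg_mem_nhds_zero H hV)).mono ?_
    rintro t ⟨s, hs, hts⟩ x
    rw [hηu, hηu]
    by_cases hx : ∃ y, (x, y) ∈ L
    · obtain ⟨y, hy⟩ := hx
      have hty : (t + x, s + y) ∈ L := L.add_mem hts hy
      rw [hu1 hy, hu1 hty]
      refine (hVf _ _ ?_).le
      have : y - w - (s + y - w) = -s := by abel
      rwa [this]
    · have hx' : ¬ ∃ y, (t + x, y) ∈ L := by
        rintro ⟨y, hy⟩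
        exact hx ⟨y - s, by simpa using L.sub_mem hy hts⟩
      rw [hu0 hx, hu0 hx']
      simpa using hε.le
  · rintro rfl
    -- Density of the projection to `H` yields a lattice point where the bump is nonzero.
    obtain ⟨_, hz, ⟨x, y⟩, hxy, rfl⟩ := hL.dense_snd.inter_open_nonempty {z | f (z - w) ≠ 0}
      (isOpen_ne.preimage (hf.comp (continuous_sub_right w))) ⟨w, by simp [hf0]⟩
    have := hηu x
    rw [hu1 hxy] at this
    exact hz (by simpa using this.symm)

end FromModelSet

/-! ### A cut and project scheme from a seminorm on `G` -/

section ToModelSet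

open UniformSpace

theorem ball_subset_closure_image_ball {E : Type*} [SeminormedAddCommGroup E] (x : E) (r : ℝ) :
    Metric.ball (x : Completion E) r ⊆ closure ((↑) '' Metric.ball x r) := by
  refine (Completion.denseRange_coe.open_subset_closure_inter Metric.isOpen_ball).trans
    (closure_mono ?_)
  rintro _ ⟨hy, y, rfl⟩
  exact ⟨y, by simpa [Completion.dist_eq] using hy, rfl⟩

variable {G : Type u} [AddCommGroup G] {E : Type u} [SeminormedAddCommGroup E] (e : G ≃+ E)

/-- The graph of the map from `G` to the completion of `G` with respect to a second group
topology, given by a seminorm. -/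
noncomputable def completionGraph : AddSubgroup (G × Completion E) :=
  ((Completion.toCompl : E →+ Completion E).comp e.toAddMonoidHom).graph

theorem mem_completionGraph {x : G} {h : Completion E} :
    (x, h) ∈ completionGraph e ↔ (e x : Completion E) = h :=
  Iff.rfl

variable {e} [TopologicalSpace G] {r : ℝ}

/-- Small balls of `E` are totally bounded if they are locally finite sets in `G`. -/
theorem totallyBounded_ball
    (hdense : ∀ r > 0, IsRelativelyDense {t : G | ‖e t‖ < r})
    (hfin : IsLocallyFinite {t : G | ‖e t‖ < r}) {r' : ℝ} (hr' : r' < r) :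
    TotallyBounded (Metric.ball (0 : E) r') := by
  refine Metric.totallyBounded_iff.2 fun ε hε => ?_
  -- With `y = q + c`, smallness `‖q‖ < ε` makes `c` an `ε`-approximation of `y`, while `‖q‖ < r -
  -- r'` keeps `c` in the `r`-ball, of which `C` contains only finitely many points.
  obtain ⟨C, hC, hdec⟩ := (hdense _ (lt_min hε (sub_pos.2 hr'))).exists_decomp
  refine ⟨e '' ({t : G | ‖e t‖ < r} ∩ C), (hfin C hC).image _, fun y hy => ?_⟩
  obtain ⟨q, hq, c, hc, hqc⟩ := hdec (e.symm y)
  have hy' : y = e q + e c := by rw [← map_add, ← hqc, e.apply_symm_apply]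
  have hq' : ‖e q‖ < min ε (r - r') := hq
  refine Set.mem_iUnion₂.2 ⟨e c, ⟨c, ⟨?_, hc⟩, rfl⟩, ?_⟩
  · have : e c = y - e q := by rw [hy']; abel
    have hyn : ‖y‖ < r' := by simpa using hy
    calc ‖e c‖ ≤ ‖y‖ + ‖e q‖ := by rw [this]; exact norm_sub_le _ _
      _ < r := by linarith [hq'.trans_le (min_le_right _ _)]
  · rw [Metric.mem_ball, dist_eq_norm, hy', add_sub_cancel_right]
    exact hq'.trans_le (min_le_left _ _)

theorem isCompact_closure_image_ball
    (hdense : ∀ r > 0, IsRelativelyDense {t : G | ‖e t‖ < r})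
    (hfin : IsLocallyFinite {t : G | ‖e t‖ < r}) {r' : ℝ} (hr' : r' < r) :
    IsCompact (closure ((↑) '' Metric.ball (0 : E) r' : Set (Completion E))) :=
  TotallyBounded.isCompact_of_isClosed
    ((totallyBounded_ball hdense hfin hr').image
      (Completion.uniformContinuous_coe E)).closure isClosed_closure

theorem locallyCompactSpace_completion
    (hdense : ∀ r > 0, IsRelativelyDense {t : G | ‖e t‖ < r})
    (hfin : IsLocallyFinite {t : G | ‖e t‖ < r}) (hr : 0 < r) :
    LocallyCompactSpace (Completion E) := by
  refine IsCompact.locallyCompactSpace_of_mem_nhds_of_addGroup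
    (isCompact_closure_image_ball hdense hfin (half_lt_self hr)) (x := 0) ?_
  refine Filter.mem_of_superset (Metric.ball_mem_nhds 0 (half_pos hr)) ?_
  rw [← Completion.coe_zero]
  exact ball_subset_closure_image_ball 0 _

variable [IsTopologicalAddGroup G] [T2Space G] [LocallyCompactSpace G]

theorem isCutAndProjectScheme_completionGraph
    (hdense : ∀ r > 0, IsRelativelyDense {t : G | ‖e t‖ < r})
    (hfin : IsLocallyFinite {t : G | ‖e t‖ < r}) (hr : 0 < r) :
    IsCutAndProjectScheme (completionGraph e) where
  discrete := by
    -- A graph point over `N` with second coordinate of norm below `r` comes from the locally finite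
    -- ball, so it is zero.
    obtain ⟨N, hN, hN0⟩ := hfin.exists_nhds_zero
    have hO : IsOpen (interior N ×ˢ Metric.ball (0 : Completion E) r) :=
      isOpen_interior.prod Metric.isOpen_ball
    refine discreteTopology_of_isOpen_singleton_zero ?_
    convert hO.preimage (continuous_subtype_val (p := (· ∈ completionGraph e))) using 1
    refine Set.Subset.antisymm ?_ ?_
    · rintro _ rfl
      exact ⟨mem_interior_iff_mem_nhds.2 hN, by simpa using hr⟩
    · rintro ⟨⟨x, h⟩, hx⟩ ⟨hxN, hxr⟩
      obtain rfl := (mem_completionGraph e).1 hx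
      obtain rfl := hN0 x (by simpa using hxr) (interior_subset hxN)
      exact Subtype.ext (Prod.ext rfl
        ((congrArg _ (map_zero e)).trans Completion.coe_zero))
  relativelyDense := by
    obtain ⟨C, hC, hdec⟩ := (hdense _ (half_pos hr)).exists_decomp
    have hB := isCompact_closure_image_ball hdense hfin (half_lt_self hr)
    refine IsRelativelyDense.of_decomp (K := C ×ˢ (closure ((↑) '' Metric.ball (0 : E) (r / 2)) -
      closure ((↑) '' Metric.ball (0 : E) (r / 2)) : Set (Completion E)))
      (hC.prod (isCompact_sub hB hB)) ?_
    rintro ⟨g, h⟩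
    obtain ⟨y, hy⟩ := (Completion.denseRange_coe (α := E)).exists_dist_lt h (half_pos hr)
    obtain ⟨p, hp, c, hc, hpc⟩ := hdec (g - e.symm y)
    refine ⟨(e.symm y + p, ((y + e p : E) : Completion E)), ?_, ?_, ?_⟩
    · exact (mem_completionGraph e).2 (by simp)
    · have : g - (e.symm y + p) = c := by rw [← sub_sub, hpc, add_sub_cancel_left]
      simpa [this] using hc
    · have h1 : h - y ∈ closure ((↑) '' Metric.ball (0 : E) (r / 2) : Set (Completion E)) := by
        refine ball_subset_closure_image_ball 0 _ ?_
        rw [Completion.coe_zero, mem_ball_zero_iff, ← dist_eq_norm]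
        exact hy
      have h2 : (e p : Completion E) ∈
          closure ((↑) '' Metric.ball (0 : E) (r / 2) : Set (Completion E)) :=
        subset_closure ⟨e p, by simpa using hp, rfl⟩
      have h3 : h - ((y + e p : E) : Completion E) = (h - y) - e p := by
        rw [Completion.coe_add]; abel
      simpa only [Prod.snd_sub, h3] using Set.sub_mem_sub h1 h2
  injOn_fst := by
    rintro ⟨x, h⟩ hx ⟨x', h'⟩ hx' rfl
    exact Prod.ext rfl (((mem_completionGraph e).1 hx).symm.trans ((mem_completionGraph e).1 hx'))
  dense_snd := by
    refine (Completion.denseRange_coe (α := E)).mono ?_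
    rintro _ ⟨y, rfl⟩
    exact ⟨(e.symm y, y), (mem_completionGraph e).2 (by simp), rfl⟩

/-- A set which is invariant under the elements of seminorm zero, precompact for the seminorm and
contains a ball of the seminorm is a model set. -/
theorem isModelSet_of_seminorm
    (hdense : ∀ r > 0, IsRelativelyDense {t : G | ‖e t‖ < r})
    (hfin : IsLocallyFinite {t : G | ‖e t‖ < r}) (hr : 0 < r) {A : Set G}
    (hinv : ∀ x ∈ A, ∀ t, ‖e t‖ = 0 → x + t ∈ A)
    (hA : ∃ F : Set G, F.Finite ∧ ∀ x ∈ A, ∃ c ∈ F, ‖e (x - c)‖ < r / 2)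
    {x₀ : G} {δ : ℝ} (hδ : 0 < δ) (hball : ∀ t, ‖e (t - x₀)‖ < δ → t ∈ A) : IsModelSet A := by
  have hLC := locallyCompactSpace_completion hdense hfin hr
  set S : Set (Completion E) := (fun x : G => (e x : Completion E)) '' A with hS
  have hSc : IsCompact (closure S) := by
    obtain ⟨F, hF, hAF⟩ := hA
    have hB := isCompact_closure_image_ball hdense hfin (half_lt_self hr)
    refine ((hF.image fun x : G => (e x : Completion E)).isCompact.add hB).closure_of_subset ?_
    rintro _ ⟨x, hx, rfl⟩
    obtain ⟨c, hc, hxc⟩ := hAF x hx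
    refine Set.mem_add.2 ⟨e c, ⟨c, hc, rfl⟩, (e (x - c) : E),
      subset_closure ⟨_, by simpa using hxc, rfl⟩, ?_⟩
    rw [← Completion.coe_add, ← map_add, add_sub_cancel]
  -- The image `S` alone may have empty interior. Adding the limit points outside the image of `E`
  -- fills in a ball and cannot affect the cut and project set.
  refine ⟨Completion E, inferInstance, inferInstance, inferInstance, hLC, inferInstance,
    completionGraph e, S ∪ closure S \ Set.range ((↑) : E → Completion E),
    isCutAndProjectScheme_completionGraph hdense hfin hr,
    hSc.closure_of_subset (Set.union_subset subset_closure Set.sdiff_subset), ⟨e x₀, ?_⟩, ?_⟩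
  · refine mem_interior.2 ⟨Metric.ball (e x₀ : Completion E) δ, fun h hh => ?_,
      Metric.isOpen_ball, Metric.mem_ball_self hδ⟩
    have hsub : ∀ y ∈ Metric.ball (e x₀) δ, (y : Completion E) ∈ S := by
      intro y hy
      refine ⟨e.symm y, hball _ ?_, by simp⟩
      rw [map_sub, e.apply_symm_apply, ← dist_eq_norm]
      exact hy
    by_cases hr : h ∈ Set.range ((↑) : E → Completion E)
    · obtain ⟨y, rfl⟩ := hr
      exact Or.inl (hsub y (by simpa [Completion.dist_eq] using hh))
    · refine Or.inr ⟨closure_mono ?_ (ball_subset_closure_image_ball _ _ hh), hr⟩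
      rintro _ ⟨y, hy, rfl⟩
      exact hsub y hy
  · ext x
    constructor
    · exact fun hx => ⟨e x, Or.inl ⟨x, hx, rfl⟩, (mem_completionGraph e).2 rfl⟩
    · rintro ⟨h, hh, hxh⟩
      obtain rfl := (mem_completionGraph e).1 hxh
      rcases hh with ⟨y, hy, hyx⟩ | ⟨-, hh⟩
      · have h0 : ‖e (x - y)‖ = 0 := by
          rw [← Completion.norm_coe, map_sub, Completion.coe_sub]
          simp only at hyx
          rw [hyx, sub_self, norm_zero]
        simpa using hinv y hy _ h0
      · exact absurd ⟨_, rfl⟩ hh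

end ToModelSet

/-! ### The seminorm attached to the weights -/

section TranslationSeminorm

variable {G : Type u} [AddCommGroup G]

theorem bddAbove_range_abs_sub {u : G → ℝ} (hu0 : ∀ x, 0 ≤ u x) (hu1 : ∀ x, u x ≤ 1) (t : G) :
    BddAbove (Set.range fun x => |u (t + x) - u x|) := by
  refine ⟨1, ?_⟩
  rintro _ ⟨x, rfl⟩
  exact abs_le.2 ⟨by linarith [hu0 (t + x), hu1 x], by linarith [hu1 (t + x), hu0 x]⟩

/-- The seminorm `t ↦ sup_x |u (t + x) - u x|` measuring how far `t` is from being a period of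
a function `u` with values in `[0, 1]`. -/
noncomputable def translationSeminorm (u : G → ℝ) (hu0 : ∀ x, 0 ≤ u x) (hu1 : ∀ x, u x ≤ 1) :
    AddGroupSeminorm G where
  toFun t := ⨆ x, |u (t + x) - u x|
  map_zero' := by simp
  add_le' s t := by
    refine ciSup_le fun x => ?_
    have h1 := le_ciSup (bddAbove_range_abs_sub hu0 hu1 s) (t + x)
    have h2 := le_ciSup (bddAbove_range_abs_sub hu0 hu1 t) x
    simp only [← add_assoc] at h1
    exact (abs_sub_le _ (u (t + x)) _).trans (add_le_add h1 h2)
  neg' t := by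
    refine le_antisymm (ciSup_le fun x => ?_) (ciSup_le fun x => ?_)
    · have := le_ciSup (bddAbove_range_abs_sub hu0 hu1 t) (-t + x)
      rw [abs_sub_comm]
      simpa using this
    · have := le_ciSup (bddAbove_range_abs_sub hu0 hu1 (-t)) (t + x)
      rw [abs_sub_comm]
      simpa using this

theorem abs_sub_le_translationSeminorm {u : G → ℝ} (hu0 : ∀ x, 0 ≤ u x) (hu1 : ∀ x, u x ≤ 1)
    (t x : G) : |u (t + x) - u x| ≤ translationSeminorm u hu0 hu1 t :=
  le_ciSup (bddAbove_range_abs_sub hu0 hu1 t) x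

theorem translationSeminorm_le {u : G → ℝ} (hu0 : ∀ x, 0 ≤ u x) (hu1 : ∀ x, u x ≤ 1)
    {t : G} {ε : ℝ} (h : ∀ x, |u (t + x) - u x| ≤ ε) : translationSeminorm u hu0 hu1 t ≤ ε :=
  ciSup_le h

end TranslationSeminorm

theorem isModelSet_of_almostPeriodic_function {G : Type u} [AddCommGroup G] [TopologicalSpace G]
    [IsTopologicalAddGroup G] [T2Space G] [LocallyCompactSpace G] {A : Set G}
    (hflc : HasFiniteLocalComplexity A) (hstable : IsPeriodStable A) {u : G → ℝ}
    (hu0 : ∀ x, 0 ≤ u x) (hu1 : ∀ x, u x ≤ 1) (huA : ∀ x, 0 < u x → x ∈ A)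
    {x₀ : G} (hx₀ : 0 < u x₀)
    (hap : ∀ ε > 0, IsRelativelyDense {t : G | ∀ x, |u (t + x) - u x| ≤ ε}) :
    IsModelSet A := by
  set p := translationSeminorm u hu0 hu1 with hp
  have hdense : ∀ r > 0, IsRelativelyDense {t : G | p t < r} := fun r hr =>
    (hap (r / 2) (half_pos hr)).mono fun t ht =>
      (translationSeminorm_le hu0 hu1 ht).trans_lt (half_lt_self hr)
  have hmem : ∀ t, p t < u x₀ → t + x₀ ∈ A := by
    intro t ht
    refine huA _ ?_
    have := (abs_lt.1 ((abs_sub_le_translationSeminorm hu0 hu1 t x₀).trans_lt ht)).1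
    linarith
  have hsub : ∀ t, p t < u x₀ → t ∈ A - A := fun t ht =>
    ⟨t + x₀, hmem t ht, x₀, huA _ hx₀, by simp⟩
  -- The kernel of `p`, contained in `A - A`: the one place where period-stability enters.
  let P : AddSubgroup G :=
    { carrier := {t | p t = 0}
      zero_mem' := map_zero p
      add_mem' := fun {s t} hs ht => le_antisymm
        ((map_add_le_add p s t).trans (by rw [hs, ht, add_zero])) (apply_nonneg p _)
      neg_mem' := fun {t} ht => (map_neg_eq_map p t).trans ht }
  have hP : (P : Set G) + A = A := hstable P fun t ht =>
    hsub t (by rw [show p t = 0 from ht]; exact hx₀)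
  refine @isModelSet_of_seminorm G _ G p.toSeminormedAddCommGroup (AddEquiv.refl G) _
    (u x₀) _ _ _ hdense (hflc.mono hsub) hx₀ A ?_ ?_ x₀ (u x₀) hx₀ ?_
  · intro x hx t ht
    rw [add_comm, ← hP]
    exact Set.add_mem_add ht hx
  · obtain ⟨C, hC, hdec⟩ := (hdense (u x₀ / 2) (half_pos hx₀)).exists_decomp
    -- For `x = q + c` in `A` with `q` small, also `q + x₀ ∈ A`; hence `c - x₀ ∈ A - A`, which has
    -- finitely many points in `C - x₀`.
    refine ⟨(· + x₀) '' ((A - A) ∩ ((· - x₀) '' C)),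
      (hflc _ (hC.image (continuous_sub_right x₀))).image _, fun x hx => ?_⟩
    obtain ⟨q, hq, c, hc, rfl⟩ := hdec x
    refine ⟨c, ⟨c - x₀, ⟨⟨q + c, hx, q + x₀, hmem q ?_, ?_⟩, c, hc, rfl⟩, ?_⟩, ?_⟩
    · exact lt_trans hq (half_lt_self hx₀)
    · simp
    · simp
    · rw [add_sub_cancel_right]
      exact hq
  · intro t ht
    have := hmem (t - x₀) ht
    simpa using this

end AperiodicOrder

theorem mainTheorem7 {G : Type u} [AddCommGroup G] [TopologicalSpace G] [IsTopologicalAddGroup G]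
    [T2Space G] [LocallyCompactSpace G] [SigmaCompactSpace G] [MeasurableSpace G] [BorelSpace G]
    (K : Set G) (hK : IsCompact K) (hKint : (interior K).Nonempty)
    (Λ : Set G) (hdense : AperiodicOrder.IsRelativelyDense Λ)
    (hstable : AperiodicOrder.IsPeriodStable Λ) :
    [AperiodicOrder.IsModelSet Λ,
      AperiodicOrder.HasFiniteLocalComplexity Λ ∧
        ∃ η : Measure G, AperiodicOrder.IsSupAlmostPeriodic η ∧ η ≠ 0 ∧
          η ≤ AperiodicOrder.diracComb Λ,
      AperiodicOrder.HasFiniteLocalComplexity Λ ∧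
        ∃ η : Measure G, AperiodicOrder.IsNormAlmostPeriodic K η ∧ η ≠ 0 ∧
          η ≤ AperiodicOrder.diracComb Λ,
      AperiodicOrder.IsUniformlyDiscrete (Λ - Λ) ∧
        ∃ η : Measure G, AperiodicOrder.IsStronglyAlmostPeriodic K η ∧ η ≠ 0 ∧
          η ≤ AperiodicOrder.diracComb Λ].TFAE := by
  have hct : AperiodicOrder.HasFiniteLocalComplexity Λ → Λ.Countable := fun h =>
    h.isLocallyFinite.countable
  tfae_have 1 → 2 := fun h =>
    ⟨h.hasFiniteLocalComplexity, h.exists_isSupAlmostPeriodic (hct h.hasFiniteLocalComplexity)⟩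
  tfae_have 2 → 1 := by
    rintro ⟨hflc, η, hη, hη0, hle⟩
    obtain ⟨x₀, hx₀⟩ := AperiodicOrder.exists_real_singleton_pos (hct hflc) hle hη0
    exact AperiodicOrder.isModelSet_of_almostPeriodic_function hflc hstable
      (u := fun x => η.real {x}) (fun x => measureReal_nonneg)
      (AperiodicOrder.real_singleton_le_one hle)
      (fun x => AperiodicOrder.mem_of_real_singleton_pos (hct hflc) hle) hx₀
      ((AperiodicOrder.isSupAlmostPeriodic_iff (hct hflc) hle).1 hη)
  tfae_have 2 ↔ 3 := and_congr_right fun hflc => exists_congr fun η =>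
    and_congr_left fun h => (AperiodicOrder.isNormAlmostPeriodic_iff_isSupAlmostPeriodic
      (hct hflc) hflc hK (hKint.mono interior_subset) h.2).symm
  tfae_have 1 → 4 := by
    intro h
    have hflc := h.hasFiniteLocalComplexity
    obtain ⟨η, hη, hη0, hle⟩ := h.exists_isSupAlmostPeriodic (hct hflc)
    exact ⟨h.isUniformlyDiscrete_sub, η,
      hη.isStronglyAlmostPeriodic (hct hflc) hflc hK hle, hη0, hle⟩
  tfae_have 4 → 2 := by
    rintro ⟨hud, η, hη, hη0, hle⟩
    have hflc : AperiodicOrder.HasFiniteLocalComplexity Λ := hud.isLocallyFinite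
    exact ⟨hflc, η, hη.isSupAlmostPeriodic (hct hflc) hud hle hη0, hη0, hle⟩
  tfae_finish
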